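/- For a real $m\times n$ matrix $A$ with $\operatorname{rank}(A)=n$, let $A^\dagger$ denote the Moore–Penrose inverse, $\kappa_2(A)=\|A\|_2\|A^\dagger\|_2$ and $\operatorname{sr}(A)=\|A\|_F^2/\|A\|_2^2$. The leverage scores of $A$ are $\ell_j=\|e_j^TQ\|_2^2$, $1\le j\le m$, where $Q$ is any $m\times n$ matrix whose columns form an orthonormal basis of $\operatorname{range}(A)$. For a real $m\times n$ matrix $\Delta A$ put $$\epsilon_F=\frac{\|\Delta A\|_F}{\|A\|_F},\qquad \epsilon_j=\frac{\|e_j^T\Delta A\|_2}{\|e_j^TA\|_2}.$$ **Theorem.** Let $A$ be a real $m\times n$ matrix with $\operatorname{rank}(A)=n$. There is a constant $C$, depending only on $A$, such that the following holds for every real $m\times n$ matrix $\Delta A$ with $\|\Delta A\|_2\,\|A^\dagger\|_2<1$. The matrix $A+\Delta A$ has rank $n$ and possesses a thin QR decomposition, and for every thin QR decomposition $A+\Delta A=\tilde Q\tilde R$ ($\tilde Q^T\tilde Q=I_n$, $\tilde R$ upper triangular) the leverage scores $\tilde\ell_j=\|e_j^T\tilde Q\|_2^2$ computed from it satisfy $$\frac{|\tilde\ell_j-\ell_j|}{\ell_j}\le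 2\left(\epsilon_j+\sqrt2\,\operatorname{sr}(A)^{1/2}\,\epsilon_F\right)\kappa_2(A)+C\,\epsilon_F^2$$ for every $1\le j\le m$ with $\ell_j>0$. -/

import Mathlib

namespace LeverageQR

open scoped Matrix

section Norms

open scoped Matrix.Norms.L2Operator in
/-- The matrix two-norm (operator norm between Euclidean spaces). -/
noncomputable def norm2 {m n : ℕ} (A : Matrix (Fin m) (Fin n) ℝ) : ℝ := ‖A‖

open scoped Matrix.Norms.Frobenius in
/-- The Frobenius norm. -/
noncomputable def normF {m n : ℕ} (A : Matrix (Fin m) (Fin n) ℝ) : ℝ := ‖A‖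

/-- The Euclidean norm of the `j`th row of `A`. -/
noncomputable def rowNorm {m n : ℕ} (A : Matrix (Fin m) (Fin n) ℝ) (j : Fin m) : ℝ :=
  ‖WithLp.toLp 2 (A j)‖

end Norms

section MoorePenrose

/-- The four Penrose equations: `X` is the Moore-Penrose inverse of the real matrix `A`. -/
structure IsMoorePenrose {m n : ℕ} (A : Matrix (Fin m) (Fin n) ℝ)
    (X : Matrix (Fin n) (Fin m) ℝ) : Prop where
  mul_mul_self : A * X * A = A
  mul_mul_inv : X * A * X = X
  symm_left : (A * X)ᵀ = A * X
  symm_right : (X * A)ᵀ = X * A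

theorem IsMoorePenrose.unique {m n : ℕ} {A : Matrix (Fin m) (Fin n) ℝ}
    {X Y : Matrix (Fin n) (Fin m) ℝ} (hX : IsMoorePenrose A X) (hY : IsMoorePenrose A Y) :
    X = Y := by
  have h1 : A * X = A * Y := by
    calc A * X = (A * X)ᵀ := hX.symm_left.symm
      _ = ((A * Y) * (A * X))ᵀ := by rw [← Matrix.mul_assoc, hY.mul_mul_self]
      _ = (A * X) * (A * Y) := by rw [Matrix.transpose_mul, hX.symm_left, hY.symm_left]
      _ = A * Y := by rw [← Matrix.mul_assoc, hX.mul_mul_self]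
  have h2 : X * A = Y * A := by
    calc X * A = (X * A)ᵀ := hX.symm_right.symm
      _ = ((X * A) * (Y * A))ᵀ := by
        rw [Matrix.mul_assoc X A (Y * A), ← Matrix.mul_assoc A Y A, hY.mul_mul_self]
      _ = (Y * A) * (X * A) := by rw [Matrix.transpose_mul, hX.symm_right, hY.symm_right]
      _ = Y * A := by rw [Matrix.mul_assoc Y A (X * A), ← Matrix.mul_assoc A X A, hX.mul_mul_self]
  calc X = X * A * X := hX.mul_mul_inv.symm
    _ = Y * A * Y := by rw [h2, Matrix.mul_assoc, h1, ← Matrix.mul_assoc]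
    _ = Y := hY.mul_mul_inv

theorem isMoorePenrose_of_rank {m n : ℕ} {A : Matrix (Fin m) (Fin n) ℝ} (hA : A.rank = n) :
    IsMoorePenrose A ((Aᵀ * A)⁻¹ * Aᵀ) := by
  have hu : IsUnit (Aᵀ * A).det := by
    rw [← Matrix.isUnit_iff_isUnit_det, ← Matrix.linearIndependent_cols_iff_isUnit,
      linearIndependent_iff_card_eq_finrank_span, Set.finrank, ← Matrix.rank_eq_finrank_span_cols,
      Matrix.rank_transpose_mul_self, hA, Fintype.card_fin]
  have hl : (Aᵀ * A)⁻¹ * Aᵀ * A = 1 := by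
    rw [Matrix.mul_assoc, Matrix.nonsing_inv_mul _ hu]
  refine ⟨?_, ?_, ?_, ?_⟩
  · rw [Matrix.mul_assoc, hl, Matrix.mul_one]
  · rw [hl, Matrix.one_mul]
  · simp [Matrix.transpose_mul, Matrix.transpose_nonsing_inv, Matrix.mul_assoc]
  · rw [hl, Matrix.transpose_one]

open Classical in
/-- The Moore-Penrose inverse (which exists and is unique; see `isMoorePenrose_pinv` for
existence in the case of full column rank). -/
noncomputable def pinv {m n : ℕ} (A : Matrix (Fin m) (Fin n) ℝ) : Matrix (Fin n) (Fin m) ℝ :=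
  if h : ∃ X, IsMoorePenrose A X then h.choose else 0

theorem isMoorePenrose_pinv {m n : ℕ} {A : Matrix (Fin m) (Fin n) ℝ} (hA : A.rank = n) :
    IsMoorePenrose A (pinv A) := by
  have h : ∃ X, IsMoorePenrose A X := ⟨_, isMoorePenrose_of_rank hA⟩
  rw [pinv, dif_pos h]
  exact h.choose_spec

end MoorePenrose

/-- The two-norm condition number with respect to left inversion. -/
noncomputable def cond2 {m n : ℕ} (A : Matrix (Fin m) (Fin n) ℝ) : ℝ :=
  norm2 A * norm2 (pinv A)

/-- The stable rank. -/
noncomputable def stableRank {m n : ℕ} (A : Matrix (Fin m) (Fin n) ℝ) : ℝ :=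
  normF A ^ 2 / norm2 A ^ 2

/-- The columns of the `m × n` matrix `Q` form an orthonormal basis of the column space
of `A`. -/
structure IsRangeBasis {m n : ℕ} (A Q : Matrix (Fin m) (Fin n) ℝ) : Prop where
  orthonormal : Qᵀ * Q = 1
  span_eq : Submodule.span ℝ (Set.range Q.col) = Submodule.span ℝ (Set.range A.col)

/-- `B = Q * R` is a thin QR decomposition of the `m × n` matrix `B`. -/
structure IsThinQR {m n : ℕ} (B Q : Matrix (Fin m) (Fin n) ℝ)
    (R : Matrix (Fin n) (Fin n) ℝ) : Prop where
  orthonormal : Qᵀ * Q = 1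
  upper : R.BlockTriangular id
  eq_mul : B = Q * R

/-- The `j`th leverage score read off a matrix `Q` with orthonormal columns. -/
noncomputable def score {m n : ℕ} (Q : Matrix (Fin m) (Fin n) ℝ) (j : Fin m) : ℝ :=
  rowNorm Q j ^ 2

/-- The relative perturbation of the `j`th row. -/
noncomputable def epsRow {m n : ℕ} (A ΔA : Matrix (Fin m) (Fin n) ℝ) (j : Fin m) : ℝ :=
  rowNorm ΔA j / rowNorm A j

/-- The relative perturbation in the Frobenius norm. -/
noncomputable def epsF {m n : ℕ} (A ΔA : Matrix (Fin m) (Fin n) ℝ) : ℝ :=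
  normF ΔA / normF A

end LeverageQR

namespace LeverageQR

open scoped Matrix

/-! ### Operator-norm estimates for orthogonal projectors and their perturbation. -/

section OperatorNorm

open scoped Matrix.Norms.L2Operator

variable {m n k : ℕ}

/-! If the columns of Q are orthonormal and span range(A), then QQᵀ is the orthogonal projector P =
AA†, so ℓ_j = P_jj whichever Q is chosen. The theorem thus compares diagonal entries of the
projectors onto range(A) and range(A + ΔA). To first order this difference is twice the diagonal of
(1 - P) ΔA A† (`abs_projection_diag_sub_first_order_le`). Since A†e_j = A†Pe_j, that column has norm
at most ‖A†‖√ℓ_j, so the ΔA A† part costs √ℓ_j times the jth row of ΔA, and the P ΔA A† part costs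
ℓ_j (`abs_first_order_le`). After division by ℓ_j, the bound ‖e_jᵀA‖ ≤ ‖A‖√ℓ_j (`rowNorm_le`) turns
the leftover 1/√ℓ_j into ε_j κ₂(A). -/

theorem norm2_eq_norm (A : Matrix (Fin m) (Fin n) ℝ) : norm2 A = ‖A‖ := rfl

theorem abs_dotProduct_le (x y : Fin n → ℝ) :
    |x ⬝ᵥ y| ≤ ‖WithLp.toLp 2 x‖ * ‖WithLp.toLp 2 y‖ := by
  have h := abs_real_inner_le_norm (WithLp.toLp 2 y) (WithLp.toLp 2 x)
  rw [EuclideanSpace.inner_toLp_toLp] at h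
  simpa [mul_comm] using h

theorem norm_toLp_sq (x : Fin n → ℝ) : ‖WithLp.toLp 2 x‖ ^ 2 = x ⬝ᵥ x := by
  rw [EuclideanSpace.norm_sq_eq]
  simp [dotProduct, pow_two]

theorem norm_transpose (A : Matrix (Fin m) (Fin n) ℝ) : ‖Aᵀ‖ = ‖A‖ := by
  rw [← Matrix.conjTranspose_eq_transpose_of_trivial, Matrix.l2_opNorm_conjTranspose]

theorem matrix_norm_mul_le_of_le {A : Matrix (Fin m) (Fin n) ℝ} {B : Matrix (Fin n) (Fin k) ℝ}
    {a b : ℝ}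
    (hA : ‖A‖ ≤ a) (hB : ‖B‖ ≤ b) : ‖A * B‖ ≤ a * b :=
  (Matrix.l2_opNorm_mul A B).trans
    (mul_le_mul hA hB (norm_nonneg _) ((norm_nonneg _).trans hA))

theorem norm_mulVec_le (A : Matrix (Fin m) (Fin n) ℝ) (x : Fin n → ℝ) :
    ‖WithLp.toLp 2 (A *ᵥ x)‖ ≤ ‖A‖ * ‖WithLp.toLp 2 x‖ :=
  Matrix.l2_opNorm_mulVec A (WithLp.toLp 2 x)

theorem abs_apply_le_norm (A : Matrix (Fin m) (Fin n) ℝ) (i : Fin m) (j : Fin n) :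
    |A i j| ≤ ‖A‖ := by
  have h := abs_dotProduct_le (Pi.single i 1) (A *ᵥ Pi.single j 1)
  have h2 := norm_mulVec_le A (Pi.single j 1)
  simp only [Matrix.mulVec_single_one, single_one_dotProduct, Matrix.col_apply,
    PiLp.toLp_single, PiLp.norm_single, norm_one, one_mul, mul_one] at h h2
  exact h.trans h2

theorem norm2_le_normF (A : Matrix (Fin m) (Fin n) ℝ) : norm2 A ≤ normF A := by
  have hF0 : 0 ≤ normF A := by
    unfold normF
    exact @norm_nonneg _ Matrix.frobeniusSeminormedAddCommGroup.toSeminormedAddGroup A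
  have hF : normF A ^ 2 = ∑ i, ‖WithLp.toLp 2 (A i)‖ ^ 2 := by
    unfold normF
    rw [Matrix.frobenius_norm_def, ← Real.sqrt_eq_rpow, Real.sq_sqrt (by positivity)]
    simp [EuclideanSpace.norm_sq_eq]
  rw [norm2_eq_norm, Matrix.l2_opNorm_def]
  refine ContinuousLinearMap.opNorm_le_bound _ hF0 fun x => ?_
  refine abs_le_of_sq_le_sq' ?_ (by positivity) |>.2
  rw [mul_pow, hF, Finset.sum_mul, EuclideanSpace.norm_sq_eq]
  refine Finset.sum_le_sum fun i _ => ?_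
  rw [← mul_pow]
  exact pow_le_pow_left₀ (norm_nonneg _) (abs_dotProduct_le (A i) x.ofLp) 2

/-- The C*-identity reads ‖P‖ = ‖P‖². -/
theorem norm_le_one_of_projection {P : Matrix (Fin m) (Fin m) ℝ} (hs : Pᵀ = P)
    (hi : P * P = P) : ‖P‖ ≤ 1 := by
  have h := Matrix.l2_opNorm_conjTranspose_mul_self P
  rw [Matrix.conjTranspose_eq_transpose_of_trivial, hs, hi] at h
  by_contra! hc
  nlinarith

theorem norm_one_sub_le_one_of_projection {P : Matrix (Fin m) (Fin m) ℝ} (hs : Pᵀ = P)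
    (hi : P * P = P) : ‖1 - P‖ ≤ 1 :=
  norm_le_one_of_projection (by simp [hs]) (by simp [sub_mul, mul_sub, hi])

theorem norm_col_sq_of_projection {P : Matrix (Fin m) (Fin m) ℝ} (hs : Pᵀ = P)
    (hi : P * P = P) (j : Fin m) : ‖WithLp.toLp 2 (P.col j)‖ ^ 2 = P j j := by
  rw [norm_toLp_sq]
  nth_rw 3 [← hi]
  nth_rw 1 [← hs]
  rfl

theorem norm_col_of_projection {P : Matrix (Fin m) (Fin m) ℝ} (hs : Pᵀ = P)
    (hi : P * P = P) (j : Fin m) : ‖WithLp.toLp 2 (P.col j)‖ = √(P j j) := by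
  rw [← norm_col_sq_of_projection hs hi, Real.sqrt_sq (norm_nonneg _)]

theorem projection_diag_mem_Icc {P : Matrix (Fin m) (Fin m) ℝ} (hs : Pᵀ = P)
    (hi : P * P = P) (j : Fin m) : P j j ∈ Set.Icc (0 : ℝ) 1 := by
  refine ⟨?_, (le_abs_self _).trans
    ((abs_apply_le_norm P j j).trans (norm_le_one_of_projection hs hi))⟩
  rw [← norm_col_sq_of_projection hs hi]
  positivity

/-- The diagonal entries of the range projectors `A * X` and `B * Y` differ, to first order in
`B - A`, by twice the diagonal entries of `(1 - A * X) * (B - A) * X`. -/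
theorem abs_projection_diag_sub_first_order_le {A B : Matrix (Fin m) (Fin n) ℝ}
    {X Y : Matrix (Fin n) (Fin m) ℝ} (hX : X * A = 1) (hXs : (A * X)ᵀ = A * X)
    (hY : Y * B = 1) (hYs : (B * Y)ᵀ = B * Y) (hsmall : ‖B - A‖ * ‖X‖ ≤ 1 / 2) (j : Fin m) :
    |(B * Y) j j - (A * X) j j - 2 * ((1 - A * X : Matrix (Fin m) (Fin m) ℝ) * (B - A) * X) j j| ≤
      11 * ‖X‖ ^ 2 * ‖B - A‖ ^ 2 := by
  obtain ⟨D, rfl⟩ : ∃ D, B = A + D := ⟨B - A, by simp⟩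
  rw [add_sub_cancel_left] at hsmall ⊢
  set B := A + D with hB
  set P := A * X with hP
  set R := B * Y with hR
  have hPA : P * A = A := by rw [hP, Matrix.mul_assoc, hX, Matrix.mul_one]
  have hRB : R * B = B := by rw [hR, Matrix.mul_assoc, hY, Matrix.mul_one]
  have hPi : P * P = P := by
    conv_lhs => rw [hP, ← Matrix.mul_assoc, ← hP, hPA]
  have hRi : R * R = R := by
    conv_lhs => rw [hR, ← Matrix.mul_assoc, ← hR, hRB]
  have hR1 : ‖R‖ ≤ 1 := norm_le_one_of_projection hYs hRi
  have hR1' : ‖1 - R‖ ≤ 1 := norm_one_sub_le_one_of_projection hYs hRi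
  have hP1' : ‖1 - P‖ ≤ 1 := norm_one_sub_le_one_of_projection hXs hPi
  have hPB : (1 - P) * R = (1 - P) * D * Y := by
    rw [hR, ← Matrix.mul_assoc, hB, Matrix.mul_add, Matrix.sub_mul 1 P A, hPA]
    simp
  have hRA : (1 - R) * P = -((1 - R) * D * X) := by
    have h : (1 - R) * A = -((1 - R) * D) := by
      rw [eq_neg_iff_add_eq_zero, ← Matrix.mul_add, ← hB, Matrix.sub_mul, hRB]; simp
    rw [hP, ← Matrix.mul_assoc, h, Matrix.neg_mul]
  -- R - P = R(1 - P) - (1 - R)P; the first term is the transpose of (1 - P)R. Each product is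
  -- linear in D because 1 - P kills A and 1 - R kills B.
  have hdiff : R - P = ((1 - P) * D * Y)ᵀ + (1 - R) * D * X := by
    rw [← hPB, ← neg_eq_iff_eq_neg.2 hRA, Matrix.transpose_mul, Matrix.transpose_sub, hXs, hYs,
      Matrix.transpose_one]
    simp [Matrix.mul_sub, Matrix.sub_mul]
  have hYR : Y * R = Y := by rw [hR, ← Matrix.mul_assoc, hY, Matrix.one_mul]
  have hYP : Y * P = X - Y * D * X := by
    have h : Y * A = 1 - Y * D := by rw [← hY, hB, Matrix.mul_add, add_sub_cancel_right]
    rw [hP, ← Matrix.mul_assoc, h, Matrix.sub_mul, Matrix.one_mul]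
  have hYX : Y - X = Y * (R - P) - Y * D * X := by
    rw [Matrix.mul_sub, hYR, hYP]; abel
  have hYeq : Y = X * R - X * D * Y := by
    have h : X * B = 1 + X * D := by rw [hB, Matrix.mul_add, hX]
    rw [hR, ← Matrix.mul_assoc, h, Matrix.add_mul, Matrix.one_mul, add_sub_cancel_right]
  -- The smallness hypothesis lets half of ‖Y‖ be absorbed on the left. The later constants follow:
  -- 3 = 2 + 1, 8 = 2·3 + 2, 11 = 8 + 3.
  have hYn : ‖Y‖ ≤ 2 * ‖X‖ := by
    have h : ‖Y‖ ≤ ‖X‖ * 1 + ‖X‖ * ‖D‖ * ‖Y‖ := by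
      conv_lhs => rw [hYeq]
      exact (norm_sub_le _ _).trans (add_le_add (matrix_norm_mul_le_of_le le_rfl hR1)
        (matrix_norm_mul_le_of_le (matrix_norm_mul_le_of_le le_rfl le_rfl) le_rfl))
    nlinarith [norm_nonneg Y]
  have hRP : ‖R - P‖ ≤ 3 * ‖X‖ * ‖D‖ := by
    rw [hdiff]
    refine (norm_add_le _ _).trans ?_
    rw [norm_transpose]
    have h1 := matrix_norm_mul_le_of_le (matrix_norm_mul_le_of_le hP1' (le_refl ‖D‖)) hYn
    have h2 := matrix_norm_mul_le_of_le (matrix_norm_mul_le_of_le hR1' (le_refl ‖D‖)) (le_refl ‖X‖)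
    linarith
  have hYXn : ‖Y - X‖ ≤ 8 * ‖X‖ ^ 2 * ‖D‖ := by
    rw [hYX]
    refine (norm_sub_le _ _).trans ?_
    have h1 := matrix_norm_mul_le_of_le hYn hRP
    have h2 := matrix_norm_mul_le_of_le (matrix_norm_mul_le_of_le hYn (le_refl ‖D‖)) (le_refl ‖X‖)
    linarith
  -- The error of replacing Y by X and R by P in `hdiff`; both replacements are O(‖D‖), so E is
  -- quadratic.
  set E := ((1 - P) * D * (Y - X))ᵀ - (R - P) * D * X with hE
  have hEn : ‖E‖ ≤ 11 * ‖X‖ ^ 2 * ‖D‖ ^ 2 := by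
    refine (norm_sub_le _ _).trans ?_
    rw [norm_transpose]
    have h1 := matrix_norm_mul_le_of_le (matrix_norm_mul_le_of_le hP1' (le_refl ‖D‖)) hYXn
    have h2 := matrix_norm_mul_le_of_le (matrix_norm_mul_le_of_le hRP (le_refl ‖D‖)) (le_refl ‖X‖)
    linarith
  have hEeq : R - P = ((1 - P) * D * X)ᵀ + (1 - P) * D * X + E := by
    rw [hdiff, hE]
    simp only [Matrix.mul_sub, Matrix.sub_mul, Matrix.transpose_sub, Matrix.one_mul]
    abel
  have hj := congrFun (congrFun hEeq j) j
  simp only [Matrix.sub_apply, Matrix.add_apply, Matrix.transpose_apply] at hj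
  have : R j j - P j j - 2 * ((1 - P : Matrix (Fin m) (Fin m) ℝ) * D * X) j j = E j j := by linarith
  rw [this]
  exact (abs_apply_le_norm E j j).trans hEn

theorem abs_first_order_le {A D : Matrix (Fin m) (Fin n) ℝ}
    {X : Matrix (Fin n) (Fin m) ℝ} (hXs : (A * X)ᵀ = A * X) (hXi : X * A * X = X)
    (j : Fin m) :
    |((1 - A * X : Matrix (Fin m) (Fin m) ℝ) * D * X) j j| ≤
      rowNorm D j * ‖X‖ * √((A * X) j j) + ‖D‖ * ‖X‖ * (A * X) j j := by
  set P := A * X with hP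
  have hPi : P * P = P := by rw [hP, Matrix.mul_assoc, ← Matrix.mul_assoc X, hXi]
  have hXP : X * P = X := by rw [hP, ← Matrix.mul_assoc, hXi]
  have hXcol : X.col j = X *ᵥ P.col j := by
    conv_lhs => rw [← hXP]
    rfl
  have hu : ‖WithLp.toLp 2 (P.col j)‖ = √(P j j) := norm_col_of_projection hXs hPi j
  have hXu : ‖WithLp.toLp 2 (X.col j)‖ ≤ ‖X‖ * √(P j j) := by
    rw [hXcol, ← hu]
    exact norm_mulVec_le _ _
  have h1 : |(D * X) j j| ≤ rowNorm D j * ‖X‖ * √(P j j) := by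
    rw [mul_assoc]
    exact (abs_dotProduct_le (D j) (X.col j)).trans
      (mul_le_mul_of_nonneg_left hXu (norm_nonneg _))
  have h2 : |(P * D * X) j j| ≤ ‖D‖ * ‖X‖ * P j j := by
    have h : (P * D * X) j j = P.col j ⬝ᵥ (D *ᵥ X.col j) := by
      rw [Matrix.mul_assoc]
      nth_rw 1 [← hXs]
      rfl
    rw [h]
    refine (abs_dotProduct_le _ _).trans ?_
    rw [hu]
    have h3 := (norm_mulVec_le D (X.col j)).trans
      (mul_le_mul_of_nonneg_left hXu (norm_nonneg _))
    have h4 := mul_le_mul_of_nonneg_left h3 (Real.sqrt_nonneg (P j j))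
    have h5 := Real.mul_self_sqrt (projection_diag_mem_Icc hXs hPi j).1
    calc _ ≤ _ := h4
      _ = ‖D‖ * ‖X‖ * (√(P j j) * √(P j j)) := by ring
      _ = _ := by rw [h5]
  have h3 : ((1 - P : Matrix (Fin m) (Fin m) ℝ) * D * X) j j = (D * X) j j - (P * D * X) j j := by
    simp [Matrix.sub_mul]
  rw [h3]
  exact (abs_sub _ _).trans (add_le_add h1 h2)

/-- AX is symmetric and fixes A, so the jth row of A is Aᵀ applied to the jth column of AX, whose
norm is √((AX)_jj). -/
theorem rowNorm_le {A : Matrix (Fin m) (Fin n) ℝ} {X : Matrix (Fin n) (Fin m) ℝ}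
    (hXs : (A * X)ᵀ = A * X) (hA : A * X * A = A) (j : Fin m) :
    rowNorm A j ≤ ‖A‖ * √((A * X) j j) := by
  have hPi : A * X * (A * X) = A * X := by rw [← Matrix.mul_assoc, hA]
  have h : A j = Aᵀ *ᵥ (A * X).col j := by
    have h1 := congrArg Matrix.transpose hA
    rw [Matrix.transpose_mul, hXs] at h1
    exact (congrArg (fun M => M.col j) h1).symm
  rw [rowNorm, h, ← norm_col_of_projection hXs hPi, ← norm_transpose A]
  exact norm_mulVec_le _ _

end OperatorNorm

/-! ### Rank, thin QR, and leverage scores as projector diagonals. -/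

section QR

open scoped Matrix.Norms.L2Operator

variable {m n : ℕ}

theorem linearIndependent_col_of_rank {A : Matrix (Fin m) (Fin n) ℝ} (hA : A.rank = n) :
    LinearIndependent ℝ A.col := by
  rw [linearIndependent_iff_card_eq_finrank_span, Set.finrank, ← Matrix.rank_eq_finrank_span_cols,
    hA, Fintype.card_fin]

theorem pinv_mul_self {A : Matrix (Fin m) (Fin n) ℝ} (hA : A.rank = n) : pinv A * A = 1 := by
  have h := (isMoorePenrose_pinv hA).mul_mul_self
  have hinj := Matrix.mulVec_injective_iff.2 (linearIndependent_col_of_rank hA)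
  refine Matrix.ext_of_mulVec_single fun i => hinj ?_
  simp only [Matrix.mulVec_mulVec, ← Matrix.mul_assoc, h, Matrix.mul_one]

/-- A kernel vector satisfies x = -A†ΔA x, a strict contraction, so x = 0. -/
theorem rank_add_of_norm_lt {A ΔA : Matrix (Fin m) (Fin n) ℝ} (hA : A.rank = n)
    (h : norm2 ΔA * norm2 (pinv A) < 1) : (A + ΔA).rank = n := by
  have hinj : Function.Injective (A + ΔA).mulVec := by
    refine (injective_iff_map_eq_zero (A + ΔA).mulVecLin).2 fun x hx => ?_
    have hx' : (A + ΔA) *ᵥ x = 0 := hx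
    have h1 : x = -(pinv A *ᵥ (ΔA *ᵥ x)) := by
      have := congrArg (fun y => pinv A *ᵥ y) hx'
      simp only [Matrix.add_mulVec, Matrix.mulVec_add, Matrix.mulVec_zero, Matrix.mulVec_mulVec,
        pinv_mul_self hA, Matrix.one_mulVec] at this
      rw [Matrix.mulVec_mulVec]
      exact eq_neg_of_add_eq_zero_left this
    have h2 : ‖WithLp.toLp 2 x‖ ≤ norm2 (pinv A) * (norm2 ΔA * ‖WithLp.toLp 2 x‖) := by
      conv_lhs => rw [h1, WithLp.toLp_neg, norm_neg]
      exact (norm_mulVec_le _ _).trans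
        (mul_le_mul_of_nonneg_left (norm_mulVec_le _ _) (norm_nonneg _))
    have h3 : ‖WithLp.toLp 2 x‖ = 0 := by
      by_contra h0
      have : 0 < ‖WithLp.toLp 2 x‖ := lt_of_le_of_ne (norm_nonneg _) (Ne.symm h0)
      nlinarith
    simpa using h3
  rw [Matrix.rank_eq_finrank_span_cols,
    finrank_span_eq_card (Matrix.mulVec_injective_iff.1 hinj), Fintype.card_fin]

/-- Each of the two symmetric projectors fixes the range of the other; transposing one absorption
identity makes them equal. -/
theorem mul_transpose_eq_mul_pinv {A Q : Matrix (Fin m) (Fin n) ℝ} {T : Matrix (Fin n) (Fin n) ℝ}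
    (hA : A.rank = n) (hQ : Qᵀ * Q = 1) (hAQ : A = Q * T) : Q * Qᵀ = A * pinv A := by
  have hQA : Q * Qᵀ * A = A := by
    rw [hAQ, Matrix.mul_assoc, ← Matrix.mul_assoc Qᵀ, hQ, Matrix.one_mul]
  -- T is square, so a left inverse is also a right inverse; hence Q = A(A†Q) lies in range(A).
  have hT : T * (pinv A * Q) = 1 := by
    rw [mul_eq_one_comm, Matrix.mul_assoc, ← hAQ, pinv_mul_self hA]
  have hAX : A * pinv A * Q = Q := by
    rw [hAQ, Matrix.mul_assoc, Matrix.mul_assoc, ← hAQ, hT, Matrix.mul_one]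
  have h1 : Q * Qᵀ * (A * pinv A) = A * pinv A := by rw [← Matrix.mul_assoc, hQA]
  have h2 : A * pinv A * (Q * Qᵀ) = Q * Qᵀ := by rw [← Matrix.mul_assoc, hAX]
  have h3 := congrArg Matrix.transpose h2
  rw [Matrix.transpose_mul, (isMoorePenrose_pinv hA).symm_left] at h3
  simp only [Matrix.transpose_mul, Matrix.transpose_transpose] at h3
  rw [← h3, h1]

theorem norm2_nonneg (A : Matrix (Fin m) (Fin n) ℝ) : 0 ≤ norm2 A := by
  rw [norm2_eq_norm]
  exact norm_nonneg _

theorem abs_projection_diag_sub_le {A ΔA : Matrix (Fin m) (Fin n) ℝ} (hA : A.rank = n)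
    (hB : (A + ΔA).rank = n) (j : Fin m) :
    |((A + ΔA) * pinv (A + ΔA)) j j - (A * pinv A) j j| ≤
      2 * (rowNorm ΔA j * norm2 (pinv A) * √((A * pinv A) j j)) +
        2 * (norm2 ΔA * norm2 (pinv A) * (A * pinv A) j j) +
        11 * norm2 (pinv A) ^ 2 * norm2 ΔA ^ 2 := by
  have hmp := isMoorePenrose_pinv hA
  have hmp' := isMoorePenrose_pinv hB
  have h01 := projection_diag_mem_Icc hmp.symm_left
    (by rw [← Matrix.mul_assoc, hmp.mul_mul_self]) j
  have h01' := projection_diag_mem_Icc hmp'.symm_left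
    (by rw [← Matrix.mul_assoc, hmp'.mul_mul_self]) j
  have hX0 := norm2_nonneg (pinv A)
  have hd0 := norm2_nonneg ΔA
  have hρ : 0 ≤ rowNorm ΔA j := norm_nonneg _
  rcases le_total (norm2 ΔA * norm2 (pinv A)) (1 / 2) with h | h
  · have h1 := abs_projection_diag_sub_first_order_le (B := A + ΔA) (pinv_mul_self hA)
      hmp.symm_left (pinv_mul_self hB) hmp'.symm_left (by simpa [norm2_eq_norm] using h) j
    have h2 := abs_first_order_le (D := ΔA) hmp.symm_left hmp.mul_mul_inv j
    rw [add_sub_cancel_left] at h1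
    simp only [← norm2_eq_norm] at h1 h2
    rw [abs_le] at h1 h2 ⊢
    constructor <;> linarith
  -- For large perturbations the trivial bound 1 suffices, since the quadratic term is already at
  -- least 11/4.
  · have h1 : |((A + ΔA) * pinv (A + ΔA)) j j - (A * pinv A) j j| ≤ 1 :=
      abs_sub_le_of_le_of_le h01'.1 h01'.2 h01.1 h01.2 |>.trans (by norm_num)
    have h2 : 0 ≤ rowNorm ΔA j * norm2 (pinv A) * √((A * pinv A) j j) := by positivity
    have h3 : 0 ≤ norm2 ΔA * norm2 (pinv A) * (A * pinv A) j j :=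
      mul_nonneg (by positivity) h01.1
    nlinarith

theorem score_eq_mul_transpose (Q : Matrix (Fin m) (Fin n) ℝ) (j : Fin m) :
    score Q j = (Q * Qᵀ) j j := by
  rw [score, rowNorm, norm_toLp_sq]
  rfl

theorem IsRangeBasis.exists_eq_mul {A Q : Matrix (Fin m) (Fin n) ℝ} (h : IsRangeBasis A Q) :
    ∃ T : Matrix (Fin n) (Fin n) ℝ, A = Q * T := by
  have hmem : ∀ j, ∃ c : Fin n → ℝ, Q *ᵥ c = A.col j := fun j => by
    have : A.col j ∈ Submodule.span ℝ (Set.range Q.col) :=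
      h.span_eq ▸ Submodule.subset_span ⟨j, rfl⟩
    rw [← Matrix.range_mulVecLin] at this
    exact this
  choose c hc using hmem
  refine ⟨(Matrix.of c)ᵀ, ?_⟩
  ext i j
  exact (congrFun (hc j) i).symm

/-- Gram–Schmidt on the columns; R holds the coefficients of the columns in the resulting
orthonormal family. -/
theorem exists_isThinQR {B : Matrix (Fin m) (Fin n) ℝ} (hB : B.rank = n) :
    ∃ Q R, IsThinQR B Q R := by
  set v : Fin n → EuclideanSpace ℝ (Fin m) := fun j => WithLp.toLp 2 (B.col j) with hv
  have hli : LinearIndependent ℝ v :=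
    (linearIndependent_col_of_rank hB).map' (WithLp.linearEquiv 2 ℝ (Fin m → ℝ)).symm.toLinearMap
      (LinearEquiv.ker _)
  set q := InnerProductSpace.gramSchmidtNormed ℝ v with hq
  have hon : Orthonormal ℝ q := InnerProductSpace.gramSchmidtNormed_orthonormal hli
  have htri : ∀ i j, j < i → inner ℝ (q i) (v j) = 0 := fun i j hij => by
    rw [hq, InnerProductSpace.gramSchmidtNormed, inner_smul_left,
      InnerProductSpace.gramSchmidt_inv_triangular ℝ v hij, mul_zero]
  refine ⟨Matrix.of fun i j => q j i, Matrix.of fun i j => inner ℝ (q i) (v j), ?_, ?_, ?_⟩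
  · ext i j
    have h := orthonormal_iff_ite.1 hon i j
    rw [PiLp.inner_apply] at h
    simp only [Matrix.mul_apply, Matrix.transpose_apply, Matrix.of_apply, Matrix.one_apply]
    rw [← h]
    simp [mul_comm]
  · intro i j hij
    exact htri i j hij
  · have hspan : ∀ j, v j ∈ Submodule.span ℝ (Set.range q) := fun j => by
      rw [hq, InnerProductSpace.span_gramSchmidtNormed_range, InnerProductSpace.span_gramSchmidt]
      exact Submodule.subset_span ⟨j, rfl⟩
    have hexp : ∀ j, v j = ∑ i, inner ℝ (q i) (v j) • q i := fun j => by
      obtain ⟨c, hc⟩ := (Submodule.mem_span_range_iff_exists_fun ℝ).1 (hspan j)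
      conv_lhs => rw [← hc]
      refine Finset.sum_congr rfl fun i _ => ?_
      rw [← hc, hon.inner_right_fintype]
    ext i j
    have := congrArg (fun w : EuclideanSpace ℝ (Fin m) => w i) (hexp j)
    simpa [hv, Matrix.mul_apply, mul_comm] using this

end QR

end LeverageQR

/-! ### The relative error bound. -/

open LeverageQR

theorem mainTheorem4 {m n : ℕ} (A : Matrix (Fin m) (Fin n) ℝ) (hA : A.rank = n) :
    ∃ C : ℝ, ∀ Q : Matrix (Fin m) (Fin n) ℝ, LeverageQR.IsRangeBasis A Q →
      ∀ ΔA : Matrix (Fin m) (Fin n) ℝ,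
        LeverageQR.norm2 ΔA * LeverageQR.norm2 (LeverageQR.pinv A) < 1 →
          (A + ΔA).rank = n ∧
          (∃ (Qt : Matrix (Fin m) (Fin n) ℝ) (Rt : Matrix (Fin n) (Fin n) ℝ),
            LeverageQR.IsThinQR (A + ΔA) Qt Rt) ∧
          ∀ (Qt : Matrix (Fin m) (Fin n) ℝ) (Rt : Matrix (Fin n) (Fin n) ℝ),
            LeverageQR.IsThinQR (A + ΔA) Qt Rt →
              ∀ j : Fin m, 0 < LeverageQR.score Q j →
                |LeverageQR.score Qt j - LeverageQR.score Q j| / LeverageQR.score Q j ≤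
                  2 * (LeverageQR.epsRow A ΔA j +
                      √2 * √(LeverageQR.stableRank A) * LeverageQR.epsF A ΔA) *
                    LeverageQR.cond2 A +
                  C * LeverageQR.epsF A ΔA ^ 2 := by
  set P := A * pinv A with hP
  have hmp := isMoorePenrose_pinv hA
  have hPi : P * P = P := by rw [hP, ← Matrix.mul_assoc, hmp.mul_mul_self]
  have hP0 : ∀ j, 0 ≤ P j j := fun j => (projection_diag_mem_Icc hmp.symm_left hPi j).1
  -- Summing over j gives one constant for all rows; terms with P_jj = 0 vanish because division by
  -- zero yields 0.
  refine ⟨∑ j, 11 * norm2 (pinv A) ^ 2 * normF A ^ 2 / P j j, fun Q hQ ΔA hΔ => ?_⟩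
  have hB := rank_add_of_norm_lt hA hΔ
  refine ⟨hB, exists_isThinQR hB, fun Qt Rt hQt j hj => ?_⟩
  obtain ⟨T, hT⟩ := hQ.exists_eq_mul
  have hs : score Q j = P j j := by
    rw [score_eq_mul_transpose, mul_transpose_eq_mul_pinv hA hQ.orthonormal hT]
  have hst : score Qt j = ((A + ΔA) * pinv (A + ΔA)) j j := by
    rw [score_eq_mul_transpose, mul_transpose_eq_mul_pinv hB hQt.orthonormal hQt.eq_mul]
  rw [hs] at hj ⊢
  rw [hst]
  have hbound := abs_projection_diag_sub_le hA hB j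
  rw [← hP] at hbound
  have hC : 11 * norm2 (pinv A) ^ 2 * normF A ^ 2 / P j j ≤
      ∑ j, 11 * norm2 (pinv A) ^ 2 * normF A ^ 2 / P j j :=
    Finset.single_le_sum (f := fun j => 11 * norm2 (pinv A) ^ 2 * normF A ^ 2 / P j j)
      (fun i _ => div_nonneg (by positivity) (hP0 i)) (Finset.mem_univ j)
  have hrow : rowNorm A j ≤ norm2 A * √(P j j) := rowNorm_le hmp.symm_left hmp.mul_mul_self j
  have hrow0 : 0 < rowNorm A j := by
    refine lt_of_le_of_ne (norm_nonneg _) fun h0 => hj.ne' ?_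
    have h1 : A j = 0 := by simpa [rowNorm] using h0.symm
    simp [hP, Matrix.mul_apply, h1]
  have hA2 : 0 < norm2 A := by
    by_contra! h
    nlinarith [mul_nonpos_of_nonpos_of_nonneg h (Real.sqrt_nonneg (P j j))]
  have hAF : 0 < normF A := hA2.trans_le (norm2_le_normF A)
  have hX0 : 0 ≤ norm2 (pinv A) := norm2_nonneg _
  have hρ : 0 ≤ rowNorm ΔA j := norm_nonneg _
  have hd := norm2_le_normF ΔA
  have hd0 := norm2_nonneg ΔA
  have hsr : √(stableRank A) = normF A / norm2 A := by
    rw [stableRank, ← div_pow, Real.sqrt_sq (by positivity)]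
  have hsp : 0 < √(P j j) := Real.sqrt_pos.2 hj
  have hsq : √(P j j) * √(P j j) = P j j := Real.mul_self_sqrt hj.le
  have h1 : 2 * (rowNorm ΔA j * norm2 (pinv A) * √(P j j)) / P j j ≤
      2 * epsRow A ΔA j * cond2 A := by
    have h : rowNorm ΔA j / √(P j j) ≤ epsRow A ΔA j * norm2 A := by
      rw [epsRow, div_mul_eq_mul_div, div_le_div_iff₀ hsp hrow0, mul_assoc]
      exact mul_le_mul_of_nonneg_left hrow hρ
    calc _ = 2 * (rowNorm ΔA j / √(P j j)) * norm2 (pinv A) := by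
          nth_rw 2 [← hsq]; field_simp
      _ ≤ 2 * (epsRow A ΔA j * norm2 A) * norm2 (pinv A) := by gcongr
      _ = _ := by rw [cond2]; ring
  have h2 : 2 * (norm2 ΔA * norm2 (pinv A) * P j j) / P j j ≤
      2 * (√2 * √(stableRank A) * epsF A ΔA) * cond2 A := by
    -- The factor √2 is slack: the argument gives this term with constant 1.
    have h2' : (1 : ℝ) ≤ √2 := Real.one_le_sqrt.2 (by norm_num)
    calc _ = 2 * (1 * norm2 ΔA * norm2 (pinv A)) := by field_simp
      _ ≤ 2 * (√2 * normF ΔA * norm2 (pinv A)) := by gcongr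
      _ = _ := by rw [hsr, epsF, cond2]; field_simp
  have h3 : 11 * norm2 (pinv A) ^ 2 * norm2 ΔA ^ 2 / P j j ≤
      (∑ j, 11 * norm2 (pinv A) ^ 2 * normF A ^ 2 / P j j) * epsF A ΔA ^ 2 := by
    calc _ ≤ 11 * norm2 (pinv A) ^ 2 * normF ΔA ^ 2 / P j j := by gcongr
      _ = 11 * norm2 (pinv A) ^ 2 * normF A ^ 2 / P j j * epsF A ΔA ^ 2 := by
          rw [epsF]; field_simp
      _ ≤ _ := mul_le_mul_of_nonneg_right hC (sq_nonneg _)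
  calc _ ≤ (2 * (rowNorm ΔA j * norm2 (pinv A) * √(P j j)) +
          2 * (norm2 ΔA * norm2 (pinv A) * P j j) +
          11 * norm2 (pinv A) ^ 2 * norm2 ΔA ^ 2) / P j j := by gcongr
    _ = 2 * (rowNorm ΔA j * norm2 (pinv A) * √(P j j)) / P j j +
          2 * (norm2 ΔA * norm2 (pinv A) * P j j) / P j j +
          11 * norm2 (pinv A) ^ 2 * norm2 ΔA ^ 2 / P j j := by ring
    _ ≤ _ := add_le_add (add_le_add h1 h2) h3
    _ = _ := by ring
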